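/- Let $X_1,X_2,\dots$ be i.i.d. real random variables with $E(X_1)=0$ and $E(X_1^2)=1$, put $S_n=\sum_{i=1}^n X_i$, and for $1\le m\le n$ let $M_n^{(m)}$ be the $m$-th largest (counted with multiplicity) of $X_1,\dots,X_n$. Suppose that there are constants $a_n>0$, $b_n\in\mathbb R$ ($n\ge1$) such that $$\lim_{n\to\infty}P\big(a_n(M_n^{(1)}-b_n)\le x\big)=G(x)\qquad\text{for all }x\in\mathbb R,$$ where $G$ is one of the extreme value distribution functions $\Lambda(x)=\exp(-e^{-x})$; $\Phi_\alpha(x)=0$ for $x\le0$ and $\Phi_\alpha(x)=\exp(-x^{-\alpha})$ for $x>0$, for some $\alpha>2$; or $\Psi_\alpha(x)=\exp(-(-x)^\alpha)$ for $x\le0$ and $\Psi_\alpha(x)=1$ for $x>0$, for some $\alpha>0$. Then for all integers $l>k\ge1$ and all $x_1,x_2,y\in\mathbb R$ with $x_1\ge x_2$, $$\lim_{n\to\infty}P\Big(a_n(M_n^{(k)}-b_n)\le x_1,\ a_n(M_n^{(l)}-b_n)\le x_2,\ \frac{S_n}{\sqrt n}\le y\Big)=\sum_{i=0}^{k-1}\sum_{j=i}^{l-1}G(x_2)\,\frac{\big(\log\frac1{G(x_1)}\big)^{i}\big(\log\frac1{G(x_2)}-\log\frac1{G(x_1)}\big)^{j-i}}{i!\,(j-i)!}\,\Phi(y),$$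 where $\Phi$ is the standard normal distribution function, $0^0=1$, and the right-hand side is read as $0$ if $G(x_2)=0$. -/

import Mathlib

open MeasureTheory ProbabilityTheory Filter Topology

/-- The Gumbel distribution function `Λ`. -/
noncomputable def gumbelDF (x : ℝ) : ℝ := Real.exp (-Real.exp (-x))

/-- The Fréchet distribution function `Φ_α`. -/
noncomputable def frechetDF (α x : ℝ) : ℝ :=
  if x ≤ 0 then 0 else Real.exp (-x ^ (-α))

/-- The Weibull-type extreme value distribution function `Ψ_α`. -/
noncomputable def weibullDF (α x : ℝ) : ℝ :=
  if x ≤ 0 then Real.exp (-(-x) ^ α) else 1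

/-- `G` is one of the admissible limit laws: `Λ`, `Φ_α` with `α > 2`, or `Ψ_α` with `α > 0`. -/
def IsAdmissibleEVD (G : ℝ → ℝ) : Prop :=
  G = gumbelDF ∨ (∃ α : ℝ, 2 < α ∧ G = frechetDF α) ∨ (∃ α : ℝ, 0 < α ∧ G = weibullDF α)

/-- The `k`-th largest (`1 ≤ k ≤ n`, counted with multiplicity) of the `n` numbers
`x 0, …, x (n - 1)`: the entry at (0-based) position `k - 1` of these numbers sorted in
decreasing order. The value for `k > n` is irrelevant (it is set to `0`). -/
noncomputable def kthLargest (x : ℕ → ℝ) (n k : ℕ) : ℝ :=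
  (((Multiset.range n).map x).sort (· ≥ ·)).getD (k - 1) 0

/-- The standard normal distribution function `Φ`. -/
noncomputable def stdNormalDF (y : ℝ) : ℝ := cdf (gaussianReal 0 1) y

/-! An order statistic is at most a level iff few enough observations exceed it. With `u x n = x / a
n + b n`, the event in the theorem thus concerns the counts of observations in the disjoint sets `(u
x₁ n, ∞)` and `(u x₂ n, u x₁ n]`, together with the normalized sum. The law of the maximum is a
power `(1 - pₙ)ⁿ`, so its convergence to `G x > 0` forces the expected number of exceedances `n pₙ`
to tend to `-log (G x)`. The two counts therefore have asymptotic means `-log (G x₁)` and `log (G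
x₁) - log (G x₂)`. Counts and sum form a sum of i.i.d. vectors in `ℝ³`, with characteristic function
`(1 + gₙ)ⁿ`. In the limit of `n gₙ` the Gaussian exponent and the two Poisson exponents simply add:
a set hit with probability `O(1/n)` carries too little second moment for `exp(iθX/√n)` to matter
there (`tendsto_nat_mul_setIntegral_cexp`). Lévy's theorem then gives joint convergence to
independent Poisson, Poisson and normal variables (`tendsto_measureReal_hitCount_eq`), and summing
over the values of the counts gives the formula. If `G x₂ = 0`, the expected count diverges and a
Chernoff bound sends the probability to `0`. -/

/-! ### Order statistics as exceedance counts. -/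

theorem List.getElem_le_iff_countP_le {u : ℝ} : ∀ {L : List ℝ}, L.Pairwise (· ≥ ·) → ∀ {m : ℕ}
    (hm : m < L.length), L[m] ≤ u ↔ L.countP (fun z => decide (u < z)) ≤ m
  | [], _, m, hm => by simp at hm
  | z :: L, hL, m, hm => by
    rw [List.pairwise_cons] at hL
    by_cases hz : u < z
    · rw [List.countP_cons_of_pos (by simpa using hz)]
      cases m with
      | zero => simpa using hz
      | succ m =>
        rw [List.getElem_cons_succ, getElem_le_iff_countP_le hL.2 (by simpa using hm)]
        omega
    · have h0 : L.countP (fun z => decide (u < z)) = 0 := by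
        rw [List.countP_eq_zero]
        intro w hw
        simpa using (hL.1 w hw).trans (not_lt.1 hz)
      rw [List.countP_cons_of_neg (by simpa using hz), h0]
      refine iff_of_true ?_ (Nat.zero_le _)
      cases m with
      | zero => simpa using hz
      | succ m =>
        rw [List.getElem_cons_succ]
        exact (hL.1 _ (List.getElem_mem _)).trans (not_lt.1 hz)

/-- The `k`-th largest of `n` numbers is at most `u` iff fewer than `k` of them exceed `u`. -/
theorem kthLargest_le_iff (x : ℕ → ℝ) {n k : ℕ} (hk : 1 ≤ k) (hkn : k ≤ n) (u : ℝ) :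
    kthLargest x n k ≤ u ↔ ((Finset.range n).filter (fun i => u < x i)).card < k := by
  have hlen : k - 1 < (((Multiset.range n).map x).sort (· ≥ ·)).length := by
    simp; omega
  rw [kthLargest, List.getD_eq_getElem _ _ hlen,
    List.getElem_le_iff_countP_le (Multiset.pairwise_sort _ _) hlen]
  have : (((Multiset.range n).map x).sort (· ≥ ·)).countP (fun z => decide (u < z))
      = ((Finset.range n).filter (fun i => u < x i)).card := by
    rw [← Multiset.coe_countP (p := fun z => u < z), Multiset.sort_eq, Multiset.countP_map]
    rfl
  rw [this]
  omega

/-! ### Expected numbers of exceedances from the law of the maximum. -/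

/-- If `(1 - pₙ)ⁿ → g > 0` with `pₙ ≤ 1`, then `n pₙ → -log g`. -/
theorem tendsto_nat_mul_of_one_sub_pow {p : ℕ → ℝ} {g : ℝ} (hp1 : ∀ n, p n ≤ 1)
    (hg : 0 < g) (h : Tendsto (fun n : ℕ => (1 - p n) ^ n) atTop (𝓝 g)) :
    Tendsto (fun n : ℕ => n * p n) atTop (𝓝 (-Real.log g)) := by
  set q : ℕ → ℝ := fun n => -Real.log (1 - p n)
  have hq : Tendsto (fun n : ℕ => n * q n) atTop (𝓝 (-Real.log g)) := by
    refine (h.log hg.ne').neg.congr fun n => ?_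
    simp [q, Real.log_pow]
  have hq0 : Tendsto q atTop (𝓝 0) := tendsto_zero_of_tendsto_mul_atTop hq
  have hpq : ∀ᶠ n in atTop, p n = 1 - Real.exp (-q n) := by
    filter_upwards [h.eventually (lt_mem_nhds hg), eventually_ne_atTop 0] with n hn hn0
    have : 0 < 1 - p n := by
      refine lt_of_le_of_ne (by linarith [hp1 n]) fun h0 => ?_
      rw [← h0, zero_pow hn0] at hn
      exact lt_irrefl _ hn
    simp [q, Real.exp_log this]
  -- Squeeze: `p = 1 - exp (-q)` lies between `q - q ^ 2` and `q` for small `q`, and `n q ^ 2 → 0`.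
  have hlow : Tendsto (fun n : ℕ => n * q n - (n * q n) * q n) atTop (𝓝 (-Real.log g)) := by
    simpa using hq.sub (hq.mul hq0)
  refine tendsto_of_tendsto_of_tendsto_of_le_of_le' hlow hq ?_ ?_
  · filter_upwards [hpq, hq0.norm.eventually (gt_mem_nhds (show ‖(0 : ℝ)‖ < 1 by simp))] with n hn h1
    have := Real.abs_exp_sub_one_sub_id_le (x := -q n) (by simpa using h1.le)
    have := (abs_le.1 this).2
    rw [hn, mul_assoc, ← mul_sub]
    exact mul_le_mul_of_nonneg_left (by nlinarith) (Nat.cast_nonneg n)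
  · filter_upwards [hpq] with n hn
    rw [hn]
    exact mul_le_mul_of_nonneg_left (by linarith [Real.add_one_le_exp (-q n)]) (Nat.cast_nonneg n)

/-- If `(1 - pₙ)ⁿ → 0` with `0 ≤ pₙ`, then `n pₙ → ∞`. -/
theorem tendsto_nat_mul_atTop_of_one_sub_pow {p : ℕ → ℝ} (hp0 : ∀ n, 0 ≤ p n)
    (h : Tendsto (fun n : ℕ => (1 - p n) ^ n) atTop (𝓝 0)) :
    Tendsto (fun n : ℕ => n * p n) atTop atTop := by
  rw [tendsto_atTop]
  intro K
  -- If `n p < K` and `n ≥ 2K`, then `p ≤ 1/2`, where `1 - p ≥ exp (-2p)`; hence the power would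
  -- exceed `exp (-2K)`.
  have hK : 0 < Real.exp (-(2 * K)) := Real.exp_pos _
  filter_upwards [h.eventually (gt_mem_nhds hK), eventually_ge_atTop (Nat.ceil (2 * K))] with n hn hnK
  by_contra! hlt
  have hnK' : 2 * K ≤ n := Nat.ceil_le.1 hnK
  have hp : p n ≤ 1 / 2 := by
    by_contra! hp
    nlinarith [hp0 n, (Nat.cast_nonneg n : (0 : ℝ) ≤ n)]
  have h1 : Real.exp (-(2 * p n)) ≤ 1 - p n := by
    have h2 := Real.add_one_le_exp (2 * p n)
    rw [Real.exp_neg]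
    refine inv_le_of_inv_le₀ (by linarith) (le_trans ?_ h2)
    rw [inv_le_iff_one_le_mul₀ (by linarith)]
    nlinarith [hp0 n]
  have h3 : Real.exp (-(2 * (n * p n))) ≤ (1 - p n) ^ n := by
    refine le_trans (le_of_eq ?_) (pow_le_pow_left₀ (Real.exp_pos _).le h1 n)
    rw [← Real.exp_nat_mul]
    ring_nf
  have := Real.exp_lt_exp.1 (h3.trans_lt hn)
  linarith

/-! ### Characteristic function asymptotics for one observation. -/

section
variable {Ω : Type*} [MeasurableSpace Ω] {P : Measure Ω} [IsProbabilityMeasure P]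

/-- Cauchy–Schwarz on `A`: the quadratic `c ↦ ∫_A (c - |X|)²` is nonnegative, so its discriminant is
not positive. -/
theorem sq_setIntegral_abs_le {X : Ω → ℝ} (hX : MemLp X 2 P) (A : Set Ω) :
    (∫ ω in A, |X ω| ∂P) ^ 2 ≤ P.real A * ∫ ω in A, X ω ^ 2 ∂P := by
  have i1 : IntegrableOn (fun ω => |X ω|) A P := (hX.integrable (by norm_num)).abs.integrableOn
  have i2 : IntegrableOn (fun ω => X ω ^ 2) A P := hX.integrable_sq.integrableOn
  have key : ∀ c : ℝ, 0 ≤ P.real A * (c * c) + (-2 * ∫ ω in A, |X ω| ∂P) * c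
      + ∫ ω in A, X ω ^ 2 ∂P := by
    intro c
    have : ∫ ω in A, (c - |X ω|) ^ 2 ∂P = P.real A * (c * c) + (-2 * ∫ ω in A, |X ω| ∂P) * c
      + ∫ ω in A, X ω ^ 2 ∂P := by
      have e : (fun ω => (c - |X ω|) ^ 2) = fun ω => (c * c + (-2 * c) * |X ω|) + X ω ^ 2 := by
        ext ω
        rw [sub_sq, sq_abs]; ring
      rw [e, integral_add _ i2, integral_add (integrable_const _) (i1.const_mul _),
        integral_const_mul (-2 * c)]
      · simp; ring
      · exact (integrable_const _).add (i1.const_mul _)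
    rw [← this]
    exact integral_nonneg fun ω => sq_nonneg _
  have := discrim_le_zero key
  rw [discrim] at this
  linarith

/-- On events of probability `~ s / n`, the factor `exp (i θ X / √n)` is negligible. -/
theorem tendsto_nat_mul_setIntegral_cexp {X : Ω → ℝ} (hX : Measurable X)
    (hX2 : MemLp X 2 P) {A : ℕ → Set Ω} {s : ℝ}
    (h : Tendsto (fun n : ℕ => n * P.real (A n)) atTop (𝓝 s)) (θ : ℝ) :
    Tendsto (fun n : ℕ => (n : ℂ) * ∫ ω in A n,
      Complex.exp (((θ * ((√n)⁻¹ * X ω) : ℝ) : ℂ) * Complex.I) ∂P) atTop (𝓝 (s : ℂ)) := by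
  have hP0 : Tendsto (fun n => P.real (A n)) atTop (𝓝 0) := tendsto_zero_of_tendsto_mul_atTop h
  -- Absolute continuity of the integral of `X ^ 2`; this is what makes the Cauchy–Schwarz bound
  -- below vanish.
  have hq : Tendsto (fun n => ∫ ω in A n, X ω ^ 2 ∂P) atTop (𝓝 0) := by
    refine hX2.integrable_sq.tendsto_setIntegral_nhds_zero ?_
    have := ENNReal.tendsto_ofReal hP0
    simpa [Function.comp_def] using this
  have hsq : Tendsto (fun n : ℕ => θ ^ 2 * ((n * P.real (A n)) * ∫ ω in A n, X ω ^ 2 ∂P)) atTop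
      (𝓝 0) := by
    simpa using (h.mul hq).const_mul (θ ^ 2)
  have hdiff : Tendsto (fun n : ℕ => ((n : ℂ) * ∫ ω in A n,
      Complex.exp (((θ * ((√n)⁻¹ * X ω) : ℝ) : ℂ) * Complex.I) ∂P)
      - ((n * P.real (A n) : ℝ) : ℂ)) atTop (𝓝 0) := by
    rw [tendsto_zero_iff_norm_tendsto_zero]
    have hsq' : Tendsto (fun n : ℕ => √(θ ^ 2 * ((n * P.real (A n)) * ∫ ω in A n, X ω ^ 2 ∂P)))
      atTop (𝓝 0) := by simpa using hsq.sqrt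
    refine squeeze_zero (fun n => norm_nonneg _) (fun n => ?_) hsq'
    have iE : IntegrableOn (fun ω => Complex.exp (((θ * ((√n)⁻¹ * X ω) : ℝ) : ℂ) * Complex.I))
        (A n) P := by
      refine Integrable.of_bound (C := 1) (by fun_prop) (.of_forall fun ω => ?_)
      rw [Complex.norm_exp_ofReal_mul_I]
    have e1 : ((n : ℂ) * ∫ ω in A n, Complex.exp (((θ * ((√n)⁻¹ * X ω) : ℝ) : ℂ) * Complex.I) ∂P)
        - ((n * P.real (A n) : ℝ) : ℂ) = n * ∫ ω in A n,
          (Complex.exp (((θ * ((√n)⁻¹ * X ω) : ℝ) : ℂ) * Complex.I) - 1) ∂P := by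
      rw [integral_sub iE (integrable_const _)]
      simp [mul_sub]
    have e2 : ‖∫ ω in A n, (Complex.exp (((θ * ((√n)⁻¹ * X ω) : ℝ) : ℂ) * Complex.I) - 1) ∂P‖
        ≤ |θ| * (√n)⁻¹ * ∫ ω in A n, |X ω| ∂P := by
      rw [← integral_const_mul]
      refine norm_integral_le_of_norm_le
        ((hX2.integrable (by norm_num)).abs.integrableOn.const_mul _) (.of_forall fun ω => ?_)
      have := Real.norm_exp_I_mul_ofReal_sub_one_le (x := θ * ((√n)⁻¹ * X ω))
      rw [mul_comm Complex.I] at this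
      refine this.trans (le_of_eq ?_)
      rw [Real.norm_eq_abs, abs_mul, abs_mul, abs_of_nonneg (inv_nonneg.2 (Real.sqrt_nonneg _))]
      ring
    rw [e1, norm_mul, Complex.norm_natCast]
    refine Real.le_sqrt_of_sq_le ?_
    have hJ : 0 ≤ ∫ ω in A n, |X ω| ∂P := integral_nonneg fun _ => abs_nonneg _
    calc _ ≤ (n * (|θ| * (√n)⁻¹ * ∫ ω in A n, |X ω| ∂P)) ^ 2 := by gcongr
      _ = θ ^ 2 * (n * (∫ ω in A n, |X ω| ∂P) ^ 2) := by
        rcases Nat.eq_zero_or_pos n with rfl | hn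
        · simp
        · have : (√(n : ℝ)) ^ 2 = n := Real.sq_sqrt (Nat.cast_nonneg n)
          have hn' : (n : ℝ) ≠ 0 := by positivity
          rw [mul_pow, mul_pow, mul_pow, inv_pow, this, sq_abs]
          field_simp
      _ ≤ θ ^ 2 * (n * (P.real (A n) * ∫ ω in A n, X ω ^ 2 ∂P)) := by
        gcongr
        exact sq_setIntegral_abs_le hX2 _
      _ = _ := by ring
  have := hdiff.add ((Complex.continuous_ofReal.tendsto s).comp h)
  simpa [Function.comp_def] using this

/-- Second order expansion of the characteristic function along `θ / √n`. -/
theorem tendsto_nat_mul_charFun_sub_one {X : Ω → ℝ} (hX : Measurable X)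
    (h0 : ∫ ω, X ω ∂P = 0) (h1 : ∫ ω, X ω ^ 2 ∂P = 1) (θ : ℝ) :
    Tendsto (fun n : ℕ => (n : ℂ) * (charFun (P.map X) ((√n)⁻¹ * θ) - 1)) atTop
      (𝓝 (-(θ : ℂ) ^ 2 / 2)) := by
  have ht : Tendsto (fun n : ℕ => (√n)⁻¹ * θ) atTop (𝓝 0) := by
    rw [← zero_mul θ]
    exact .mul_const θ (tendsto_inv_atTop_zero.comp <| Real.tendsto_sqrt_atTop.comp <|
      tendsto_natCast_atTop_atTop)
  have ho := (taylor_charFun_two (P := P) hX.aemeasurable h0 (by simpa using h1)).comp_tendsto ht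
  have ho2 : (fun n : ℕ => (n : ℂ) * (charFun (P.map X) ((√n)⁻¹ * θ)
      - (1 - (((√n)⁻¹ * θ : ℝ) : ℂ) ^ 2 / 2))) =o[atTop] (fun _ : ℕ => (1 : ℝ)) := by
    have hb : (fun n : ℕ => (n : ℂ)) =O[atTop] fun n : ℕ => (n : ℝ) :=
      Asymptotics.IsBigO.of_bound 1 (.of_forall fun n => by simp)
    refine (hb.mul_isLittleO ho).trans_isBigO ?_
    refine Asymptotics.IsBigO.of_bound (θ ^ 2) (.of_forall fun n => ?_)
    rcases Nat.eq_zero_or_pos n with rfl | hn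
    · simp; positivity
    · have : (√(n : ℝ)) ^ 2 = n := Real.sq_sqrt (Nat.cast_nonneg n)
      have hn' : (n : ℝ) ≠ 0 := by positivity
      simp only [Function.comp, mul_pow, inv_pow, this]
      rw [mul_inv_cancel_left₀ hn']
      simp
  have hz := (Asymptotics.isLittleO_one_iff ℝ).1 ho2
  have hc : Tendsto (fun n : ℕ => (n : ℂ) * (charFun (P.map X) ((√n)⁻¹ * θ)
      - (1 - (((√n)⁻¹ * θ : ℝ) : ℂ) ^ 2 / 2)) + -(θ : ℂ) ^ 2 / 2) atTop
      (𝓝 (-(θ : ℂ) ^ 2 / 2)) := by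
    simpa using hz.add_const (-(θ : ℂ) ^ 2 / 2)
  refine hc.congr' ?_
  filter_upwards [eventually_ne_atTop 0] with n hn
  have : ((√(n : ℝ) : ℝ) : ℂ) ^ 2 = n := by
    rw [← Complex.ofReal_pow, Real.sq_sqrt (Nat.cast_nonneg n)]; simp
  have hn' : (n : ℂ) ≠ 0 := by exact_mod_cast hn
  push_cast
  rw [mul_pow, inv_pow, this]
  field_simp
  ring
end

/-! ### The joint vector of counts and sum, and its limit law. -/

/-- The marginal laws of the joint limit: two Poisson laws and the standard normal law. -/
noncomputable def limitMarginal (s t : NNReal) : Fin 3 → Measure ℝ :=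
  ![(poissonMeasure s).map (Nat.cast : ℕ → ℝ), (poissonMeasure t).map (Nat.cast : ℕ → ℝ),
    gaussianReal 0 1]

instance (s t : NNReal) (i : Fin 3) : IsProbabilityMeasure (limitMarginal s t i) := by
  fin_cases i
  · exact Measure.isProbabilityMeasure_map (by fun_prop)
  · exact Measure.isProbabilityMeasure_map (by fun_prop)
  · exact (inferInstance : IsProbabilityMeasure (gaussianReal 0 1))

/-- The contribution of an observation `x` to the two counts and to the normalized sum. -/
noncomputable def jointSummand (A B : Set ℝ) (n : ℕ) (x : ℝ) : EuclideanSpace ℝ (Fin 3) :=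
  !₂[A.indicator 1 x, B.indicator 1 x, (√(n : ℝ))⁻¹ * x]

theorem measurable_jointSummand {A B : Set ℝ} (hA : MeasurableSet A) (hB : MeasurableSet B)
    (n : ℕ) : Measurable (jointSummand A B n) := by
  have h1 : Measurable (A.indicator (1 : ℝ → ℝ)) := measurable_one.indicator hA
  have h2 : Measurable (B.indicator (1 : ℝ → ℝ)) := measurable_one.indicator hB
  refine (WithLp.measurable_toLp 2 (Fin 3 → ℝ)).comp (measurable_pi_iff.2 fun i => ?_)
  fin_cases i
  · exact h1
  · exact h2
  · exact measurable_const.mul measurable_id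

/-- The number of the first `n` observations falling in `A`. -/
noncomputable def hitCount {Ω : Type*} (X : ℕ → Ω → ℝ) (A : Set ℝ) (n : ℕ) (ω : Ω) : ℕ := by
  classical exact ((Finset.range n).filter fun i => X i ω ∈ A).card

theorem cast_hitCount {Ω : Type*} (X : ℕ → Ω → ℝ) (A : Set ℝ) (n : ℕ) (ω : Ω) :
    (hitCount X A n ω : ℝ) = ∑ i ∈ Finset.range n, A.indicator 1 (X i ω) := by
  classical
  rw [hitCount, Finset.card_filter, Nat.cast_sum]
  exact Finset.sum_congr rfl fun i _ => by simp [Set.indicator_apply]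

section
variable {Ω : Type*} [MeasurableSpace Ω] {P : Measure Ω} [IsProbabilityMeasure P]

/-- By disjointness at most one indicator is nonzero, so the exponential of the two indicator terms
is `1 + (exp (i z₀) - 1) 1_A + (exp (i z₁) - 1) 1_B`. -/
theorem charFun_jointSummand {X : Ω → ℝ} (hX : Measurable X) {A B : Set ℝ}
    (hA : MeasurableSet A) (hB : MeasurableSet B) (hAB : Disjoint A B) (n : ℕ)
    (z : EuclideanSpace ℝ (Fin 3)) :
    charFun (P.map fun ω => jointSummand A B n (X ω)) z =
      charFun (P.map X) ((√n)⁻¹ * z 2)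
      + (Complex.exp (z 0 * Complex.I) - 1) * ∫ ω in X ⁻¹' A,
          Complex.exp (((z 2 * ((√n)⁻¹ * X ω) : ℝ) : ℂ) * Complex.I) ∂P
      + (Complex.exp (z 1 * Complex.I) - 1) * ∫ ω in X ⁻¹' B,
          Complex.exp (((z 2 * ((√n)⁻¹ * X ω) : ℝ) : ℂ) * Complex.I) ∂P := by
  have hm : Measurable fun ω => jointSummand A B n (X ω) :=
    (measurable_jointSummand hA hB n).comp hX
  set E : Ω → ℂ := fun ω => Complex.exp (((z 2 * ((√n)⁻¹ * X ω) : ℝ) : ℂ) * Complex.I) with hE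
  have iE : Integrable E P := by
    refine Integrable.of_bound (C := 1) (by fun_prop) (.of_forall fun ω => ?_)
    rw [hE, Complex.norm_exp_ofReal_mul_I]
  rw [charFun_apply, charFun_apply, integral_map hm.aemeasurable (by fun_prop),
    integral_map hX.aemeasurable (by fun_prop), ← integral_indicator (hX hA),
    ← integral_indicator (hX hB), ← integral_const_mul, ← integral_const_mul,
    ← integral_add _ ((iE.indicator (hX hA)).const_mul _), ← integral_add]
  · refine integral_congr_ae (.of_forall fun ω => ?_)
    have hin : inner ℝ (jointSummand A B n (X ω)) z
        = A.indicator 1 (X ω) * z 0 + B.indicator 1 (X ω) * z 1 + z 2 * ((√n)⁻¹ * X ω) := by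
      simp [PiLp.inner_apply, Fin.sum_univ_three, jointSummand]
      ring
    have h3 : inner ℝ (X ω) ((√n)⁻¹ * z 2) = z 2 * ((√n)⁻¹ * X ω) := by
      simp; ring
    simp only [hin, h3]
    by_cases h1 : X ω ∈ A
    · have h2 : X ω ∉ B := Set.disjoint_left.1 hAB h1
      simp [h1, h2, hE, add_mul, Complex.exp_add]
      ring
    · by_cases h2 : X ω ∈ B
      · simp [h1, h2, hE, add_mul, Complex.exp_add]
        ring
      · simp [h1, h2]
  · refine Integrable.add ?_ ((iE.indicator (hX hA)).const_mul _)
    refine iE.congr (.of_forall fun ω => ?_)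
    simp [hE]
    ring_nf
  · exact (iE.indicator (hX hB)).const_mul _
  · refine iE.congr (.of_forall fun ω => ?_)
    simp [hE]
    ring_nf

variable {X : ℕ → Ω → ℝ}

/-- Convergence of the joint characteristic function of two exceedance counts and the normalized sum. -/
theorem tendsto_charFun_sum_jointSummand (hmeas : ∀ i, Measurable (X i))
    (hindep : iIndepFun X P) (hident : ∀ i, IdentDistrib (X i) (X 0) P P)
    (hmean : ∫ ω, X 0 ω ∂P = 0) (hvar : ∫ ω, (X 0 ω) ^ 2 ∂P = 1)
    {A B : ℕ → Set ℝ} (hA : ∀ n, MeasurableSet (A n)) (hB : ∀ n, MeasurableSet (B n))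
    (hAB : ∀ n, Disjoint (A n) (B n)) {s t : NNReal}
    (hs : Tendsto (fun n : ℕ => n * P.real (X 0 ⁻¹' A n)) atTop (𝓝 s))
    (ht : Tendsto (fun n : ℕ => n * P.real (X 0 ⁻¹' B n)) atTop (𝓝 t))
    (z : EuclideanSpace ℝ (Fin 3)) :
    Tendsto (fun n : ℕ => charFun
      (P.map fun ω => ∑ i ∈ Finset.range n, jointSummand (A n) (B n) n (X i ω)) z) atTop
      (𝓝 (charFun ((Measure.pi (limitMarginal s t)).map (WithLp.toLp 2)) z)) := by
  have hX2 : MemLp (X 0) 2 P := by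
    refine (memLp_two_iff_integrable_sq (hmeas 0).aestronglyMeasurable).2 ?_
    -- A nonintegrable function has integral `0`, so `hvar` already yields square integrability.
    exact .of_integral_ne_zero (by rw [hvar]; norm_num)
  have hlim : charFun ((Measure.pi (limitMarginal s t)).map (WithLp.toLp 2)) z
      = Complex.exp (-(z 2 : ℂ) ^ 2 / 2 + (Complex.exp (z 0 * Complex.I) - 1) * ((s : ℝ) : ℂ)
        + (Complex.exp (z 1 * Complex.I) - 1) * ((t : ℝ) : ℂ)) := by
    rw [charFun_pi, Fin.prod_univ_three]
    simp only [limitMarginal, Matrix.cons_val_zero, Matrix.cons_val_one, Matrix.cons_val]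
    rw [charFun_map_cast_poissonMeasure, charFun_map_cast_poissonMeasure, charFun_gaussianReal,
      ← Complex.exp_add, ← Complex.exp_add]
    congr 1
    push_cast
    ring
  rw [hlim]
  set g : ℕ → ℂ := fun n =>
    charFun (P.map fun ω => jointSummand (A n) (B n) n (X 0 ω)) z - 1 with hg
  have hpow : ∀ n, charFun
      (P.map fun ω => ∑ i ∈ Finset.range n, jointSummand (A n) (B n) n (X i ω)) z
      = (1 + g n) ^ n := by
    intro n
    have hJ := measurable_jointSummand (hA n) (hB n) n
    have hi : iIndepFun (fun i ω => jointSummand (A n) (B n) n (X i ω)) P :=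
      hindep.comp (fun _ => jointSummand (A n) (B n) n) fun _ => hJ
    have hm : ∀ i ∈ Finset.range n,
        AEMeasurable (fun ω => jointSummand (A n) (B n) n (X i ω)) P :=
      fun i _ => (hJ.comp (hmeas i)).aemeasurable
    rw [(hi.restrict _).charFun_map_fun_finsetSum_eq_prod hm, Finset.prod_apply,
      Finset.prod_congr rfl (g := fun _ => 1 + g n), Finset.prod_const, Finset.card_range]
    intro i _
    have := ((hident i).comp hJ).map_eq
    simp only [Function.comp_def] at this
    rw [this, hg]
    ring
  simp_rw [hpow]
  refine Complex.tendsto_one_add_pow_exp_of_tendsto ?_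
  have h1 := tendsto_nat_mul_charFun_sub_one (hmeas 0) hmean hvar (z 2)
  have h2 := tendsto_nat_mul_setIntegral_cexp (hmeas 0) hX2 hs (z 2)
  have h3 := tendsto_nat_mul_setIntegral_cexp (hmeas 0) hX2 ht (z 2)
  refine ((h1.add (h2.const_mul (Complex.exp (z 0 * Complex.I) - 1))).add
    (h3.const_mul (Complex.exp (z 1 * Complex.I) - 1))).congr fun n => ?_
  rw [hg]
  simp only
  rw [charFun_jointSummand (hmeas 0) (hA n) (hB n) (hAB n)]
  ring

theorem measurable_hitCount (hmeas : ∀ i, Measurable (X i)) {A : Set ℝ} (hA : MeasurableSet A)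
    (n : ℕ) : Measurable (hitCount X A n) := by
  classical
  have : hitCount X A n = fun ω => ∑ i ∈ Finset.range n, (X i ⁻¹' A).indicator (1 : Ω → ℕ) ω := by
    ext ω
    rw [hitCount, Finset.card_filter]
    exact Finset.sum_congr rfl fun i _ => by simp [Set.indicator_apply]
  rw [this]
  exact Finset.measurable_fun_sum _ fun i _ => measurable_one.indicator (hmeas i hA)

/-- Encodes `count = i` by an interval whose endpoints are half-integers, hence null for any
integer-valued law, as the portmanteau theorem needs. -/
theorem natCast_mem_Ioo_half_iff (j i : ℕ) :
    (j : ℝ) ∈ Set.Ioo ((i : ℝ) - 1 / 2) (i + 1 / 2) ↔ j = i := by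
  constructor
  · rintro ⟨h1, h2⟩
    have h3 : (i : ℝ) < j + 1 := by linarith
    have h4 : (j : ℝ) < i + 1 := by linarith
    norm_cast at h3 h4
    omega
  · rintro rfl
    constructor <;> linarith

theorem poissonMeasure_map_cast_Ioo (s : NNReal) (i : ℕ) :
    ((poissonMeasure s).map (Nat.cast : ℕ → ℝ)).real (Set.Ioo ((i : ℝ) - 1 / 2) (i + 1 / 2))
      = Real.exp (-s) * s ^ i / i.factorial := by
  rw [map_measureReal_apply (by fun_prop) measurableSet_Ioo, ← poissonMeasure_real_singleton]
  congr 1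
  ext j
  exact natCast_mem_Ioo_half_iff j i

end

/-! ### From weak convergence to probabilities of counting events. -/

/-- Reduces nullity of the boundary of a box under a product law to nullity of each marginal
boundary. -/
theorem frontier_univ_pi_subset {ι : Type*} [Finite ι] (S : ι → Set ℝ) :
    frontier (Set.univ.pi S) ⊆ ⋃ j, Function.eval j ⁻¹' frontier (S j) := by
  intro z hz
  rw [frontier, closure_pi_set, interior_pi_set Set.finite_univ] at hz
  obtain ⟨h1, h2⟩ := hz
  simp only [Set.mem_univ_pi, not_forall] at h1 h2
  obtain ⟨j, hj⟩ := h2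
  exact Set.mem_iUnion.2 ⟨j, h1 j, hj⟩

theorem hitCount_Ioi_add_hitCount_Ioc {Ω : Type*} (X : ℕ → Ω → ℝ) {v u : ℝ} (h : v ≤ u) (n : ℕ) (ω : Ω) :
    hitCount X (Set.Ioi u) n ω + hitCount X (Set.Ioc v u) n ω = hitCount X (Set.Ioi v) n ω := by
  have : (hitCount X (Set.Ioi u) n ω + hitCount X (Set.Ioc v u) n ω : ℝ)
      = hitCount X (Set.Ioi v) n ω := by
    rw [cast_hitCount, cast_hitCount, cast_hitCount, ← Finset.sum_add_distrib]
    refine Finset.sum_congr rfl fun i _ => ?_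
    have hd : Disjoint (Set.Ioc v u) (Set.Ioi u) :=
      Set.disjoint_left.2 fun z hz hz' => not_lt.2 hz.2 hz'
    rw [← Set.Ioc_union_Ioi_eq_Ioi h, Set.indicator_union_of_disjoint hd]
    exact add_comm _ _
  exact_mod_cast this

theorem kthLargest_le_iff_hitCount {Ω : Type*} (X : ℕ → Ω → ℝ) {n k : ℕ} (hk : 1 ≤ k) (hkn : k ≤ n) (u : ℝ) (ω : Ω) :
    kthLargest (fun i => X i ω) n k ≤ u ↔ hitCount X (Set.Ioi u) n ω < k := by
  rw [kthLargest_le_iff _ hk hkn, hitCount]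
  simp only [Set.mem_Ioi]

section
variable {Ω : Type*} [MeasurableSpace Ω] {P : Measure Ω} [IsProbabilityMeasure P]
  {X : ℕ → Ω → ℝ}

theorem poissonMeasure_map_cast_frontier_Ioo (s : NNReal) (i : ℕ) :
    (poissonMeasure s).map (Nat.cast : ℕ → ℝ)
      (frontier (Set.Ioo ((i : ℝ) - 1 / 2) (i + 1 / 2))) = 0 := by
  rw [frontier_Ioo (by linarith), Measure.map_apply (by fun_prop) (by measurability)]
  convert measure_empty (μ := poissonMeasure s)
  ext j
  simp only [Set.mem_preimage, Set.mem_insert_iff, Set.mem_singleton_iff, Set.mem_empty_iff_false,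
    iff_false, not_or]
  constructor <;> intro h
  · have h1 : (2 * j + 1 : ℝ) = 2 * i := by linarith
    norm_cast at h1
    omega
  · have h1 : (2 * j : ℝ) = 2 * i + 1 := by linarith
    norm_cast at h1
    omega

theorem tendsto_measureReal_hitCount_eq (hmeas : ∀ i, Measurable (X i))
    (hindep : iIndepFun X P) (hident : ∀ i, IdentDistrib (X i) (X 0) P P)
    (hmean : ∫ ω, X 0 ω ∂P = 0) (hvar : ∫ ω, (X 0 ω) ^ 2 ∂P = 1)
    {A B : ℕ → Set ℝ} (hA : ∀ n, MeasurableSet (A n)) (hB : ∀ n, MeasurableSet (B n))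
    (hAB : ∀ n, Disjoint (A n) (B n)) {s t : NNReal}
    (hs : Tendsto (fun n : ℕ => n * P.real (X 0 ⁻¹' A n)) atTop (𝓝 s))
    (ht : Tendsto (fun n : ℕ => n * P.real (X 0 ⁻¹' B n)) atTop (𝓝 t))
    (i m : ℕ) (y : ℝ) :
    Tendsto (fun n : ℕ => P.real {ω | hitCount X (A n) n ω = i ∧ hitCount X (B n) n ω = m ∧
      (∑ q ∈ Finset.range n, X q ω) / √(n : ℝ) ≤ y}) atTop
      (𝓝 ((Real.exp (-s) * s ^ i / i.factorial) * (Real.exp (-t) * t ^ m / m.factorial)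
        * stdNormalDF y)) := by
  set Z : ℕ → Ω → EuclideanSpace ℝ (Fin 3) := fun n ω =>
    ∑ q ∈ Finset.range n, jointSummand (A n) (B n) n (X q ω) with hZdef
  have hZ : ∀ n, Measurable (Z n) := fun n => Finset.measurable_fun_sum _ fun q _ =>
    (measurable_jointSummand (hA n) (hB n) n).comp (hmeas q)
  set μ : ℕ → ProbabilityMeasure (EuclideanSpace ℝ (Fin 3)) := fun n =>
    ⟨P.map (Z n), Measure.isProbabilityMeasure_map (hZ n).aemeasurable⟩
  have hL : Measurable (WithLp.toLp 2 : (Fin 3 → ℝ) → EuclideanSpace ℝ (Fin 3)) :=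
    WithLp.measurable_toLp 2 _
  set ν : ProbabilityMeasure (EuclideanSpace ℝ (Fin 3)) :=
    ⟨(Measure.pi (limitMarginal s t)).map (WithLp.toLp 2),
      Measure.isProbabilityMeasure_map hL.aemeasurable⟩ with hν
  have hconv : Tendsto μ atTop (𝓝 ν) := ProbabilityMeasure.tendsto_of_tendsto_charFun
    (tendsto_charFun_sum_jointSummand hmeas hindep hident hmean hvar hA hB hAB hs ht)
  set S : Fin 3 → Set ℝ := ![Set.Ioo ((i : ℝ) - 1 / 2) (i + 1 / 2),
    Set.Ioo ((m : ℝ) - 1 / 2) (m + 1 / 2), Set.Iic y] with hS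
  have hSm : ∀ j, MeasurableSet (S j) := by
    intro j
    fin_cases j
    · exact measurableSet_Ioo
    · exact measurableSet_Ioo
    · exact measurableSet_Iic
  have hSpi : MeasurableSet (Set.univ.pi S) := MeasurableSet.univ_pi hSm
  set e := (PiLp.continuousLinearEquiv 2 ℝ (fun _ : Fin 3 => ℝ)).toHomeomorph
  have hfr : ∀ j, limitMarginal s t j (frontier (S j)) = 0 := by
    intro j
    fin_cases j
    · exact poissonMeasure_map_cast_frontier_Ioo s i
    · exact poissonMeasure_map_cast_frontier_Ioo t m
    · have := nullSingletonClass_gaussianReal (μ := 0) one_ne_zero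
      change gaussianReal 0 1 (frontier (Set.Iic y)) = 0
      rw [frontier_Iic]
      exact measure_singleton y
  have hfrontier : (ν : Measure (EuclideanSpace ℝ (Fin 3))) (frontier (e ⁻¹' Set.univ.pi S)) = 0 := by
    rw [← e.preimage_frontier, hν, ProbabilityMeasure.coe_mk,
      Measure.map_apply hL (e.continuous.measurable isClosed_frontier.measurableSet)]
    refine measure_mono_null (frontier_univ_pi_subset S) (measure_iUnion_null fun j => ?_)
    rw [(measurePreserving_eval (limitMarginal s t) j).measure_preimage
      isClosed_frontier.measurableSet.nullMeasurableSet]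
    exact hfr j
  have hmain := (ENNReal.tendsto_toReal (measure_ne_top _ _)).comp
    (ProbabilityMeasure.tendsto_measure_of_null_frontier_of_tendsto' hconv hfrontier)
  have hν_eq : ((ν : Measure (EuclideanSpace ℝ (Fin 3))) (e ⁻¹' Set.univ.pi S)).toReal
      = (Real.exp (-s) * s ^ i / i.factorial) * (Real.exp (-t) * t ^ m / m.factorial)
        * stdNormalDF y := by
    rw [hν, ProbabilityMeasure.coe_mk, Measure.map_apply hL (e.continuous.measurable hSpi)]
    change ((Measure.pi (limitMarginal s t)) (Set.univ.pi S)).toReal = _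
    rw [Measure.pi_pi, ENNReal.toReal_prod, Fin.prod_univ_three, ← poissonMeasure_map_cast_Ioo,
      ← poissonMeasure_map_cast_Ioo, stdNormalDF, cdf_eq_real]
    rfl
  rw [hν_eq] at hmain
  refine hmain.congr fun n => ?_
  simp only [Function.comp_apply]
  change ((P.map (Z n)) (e ⁻¹' Set.univ.pi S)).toReal = _
  rw [Measure.map_apply (hZ n) (e.continuous.measurable hSpi), measureReal_def]
  congr 2
  ext ω
  have h0 : Z n ω 0 = hitCount X (A n) n ω := by
    simp [hZdef, cast_hitCount, jointSummand]
  have h1 : Z n ω 1 = hitCount X (B n) n ω := by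
    simp [hZdef, cast_hitCount, jointSummand]
  have h2 : Z n ω 2 = (∑ q ∈ Finset.range n, X q ω) / √(n : ℝ) := by
    simp [hZdef, jointSummand, div_eq_inv_mul, Finset.mul_sum]
  change (∀ j, j ∈ Set.univ → Z n ω j ∈ S j) ↔ _
  simp only [Set.mem_univ, true_imp_iff, Fin.forall_fin_succ, IsEmpty.forall_iff, and_true]
  change (Z n ω 0 ∈ Set.Ioo _ _ ∧ Z n ω 1 ∈ Set.Ioo _ _ ∧ Z n ω 2 ∈ Set.Iic y) ↔ _
  rw [h0, h1, h2, natCast_mem_Ioo_half_iff, natCast_mem_Ioo_half_iff]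
  rfl

theorem measureReal_kthLargest_one_le (hmeas : ∀ i, Measurable (X i))
    (hindep : iIndepFun X P) (hident : ∀ i, IdentDistrib (X i) (X 0) P P) {n : ℕ} (hn : 1 ≤ n)
    (u : ℝ) : P.real {ω | kthLargest (fun i => X i ω) n 1 ≤ u}
      = (1 - P.real (X 0 ⁻¹' Set.Ioi u)) ^ n := by
  have h1 : {ω | kthLargest (fun i => X i ω) n 1 ≤ u}
      = ⋂ i ∈ Finset.range n, X i ⁻¹' Set.Iic u := by
    ext ω
    simp only [Set.mem_ofPred_eq, kthLargest_le_iff (fun i => X i ω) le_rfl hn, Nat.lt_one_iff,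
      Finset.card_eq_zero, Finset.filter_eq_empty_iff, not_lt, Set.mem_iInter, Set.mem_preimage,
      Set.mem_Iic]
  rw [h1, measureReal_def, hindep.measure_inter_preimage_eq_mul (S := Finset.range n)
    (sets := fun _ => Set.Iic u) (fun _ _ => measurableSet_Iic), ENNReal.toReal_prod,
    Finset.prod_congr rfl (g := fun _ => 1 - P.real (X 0 ⁻¹' Set.Ioi u)), Finset.prod_const,
    Finset.card_range]
  intro i _
  rw [(hident i).measure_mem_eq measurableSet_Iic, ← measureReal_def,
    ← probReal_compl_eq_one_sub (hmeas 0 measurableSet_Ioi), ← Set.preimage_compl, Set.compl_Ioi]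

/-! ### Diverging expected counts, and summation over count values. -/

/-- If the expected number of hits tends to infinity, the number of hits is rarely bounded. -/
theorem tendsto_measureReal_hitCount_le (hmeas : ∀ i, Measurable (X i))
    (hindep : iIndepFun X P) (hident : ∀ i, IdentDistrib (X i) (X 0) P P)
    {A : ℕ → Set ℝ} (hA : ∀ n, MeasurableSet (A n))
    (h : Tendsto (fun n : ℕ => n * P.real (X 0 ⁻¹' A n)) atTop atTop) (l : ℕ) :
    Tendsto (fun n : ℕ => P.real {ω | (hitCount X (A n) n ω : ℝ) ≤ l}) atTop (𝓝 0) := by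
  -- Chernoff bound at parameter `-1`: an indicator of probability `p` has moment generating
  -- function `1 - c p ≤ exp (-c p)` there.
  set c : ℝ := 1 - Real.exp (-1) with hc
  have hc0 : 0 < c := by simp [hc]
  have hbound : ∀ n : ℕ, P.real {ω | (hitCount X (A n) n ω : ℝ) ≤ l}
      ≤ Real.exp l * Real.exp (-(c * (n * P.real (X 0 ⁻¹' A n)))) := by
    intro n
    have hind : Measurable ((A n).indicator (1 : ℝ → ℝ)) := measurable_one.indicator (hA n)
    have hm1 : mgf (fun ω => (A n).indicator 1 (X 0 ω)) P (-1)
        ≤ Real.exp (-(c * P.real (X 0 ⁻¹' A n))) := by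
      have e1 : mgf (fun ω => (A n).indicator 1 (X 0 ω)) P (-1)
          = 1 - c * P.real (X 0 ⁻¹' A n) := by
        have : (fun ω => Real.exp (-1 * (A n).indicator 1 (X 0 ω)))
            = fun ω => 1 - c * (X 0 ⁻¹' A n).indicator (1 : Ω → ℝ) ω := by
          ext ω
          by_cases hω : X 0 ω ∈ A n <;> simp [hω, hc]
        rw [mgf, this, integral_sub (integrable_const _), integral_const_mul,
          integral_indicator_one (hmeas 0 (hA n))]
        · simp
        · exact ((integrable_const (1 : ℝ)).indicator (hmeas 0 (hA n))).const_mul c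
      rw [e1]
      linarith [Real.add_one_le_exp (-(c * P.real (X 0 ⁻¹' A n)))]
    have hmgf : mgf (fun ω => (hitCount X (A n) n ω : ℝ)) P (-1)
        ≤ Real.exp (-(c * (n * P.real (X 0 ⁻¹' A n)))) := by
      have e2 : (fun ω => (hitCount X (A n) n ω : ℝ))
          = ∑ i ∈ Finset.range n, fun ω => (A n).indicator 1 (X i ω) := by
        ext ω
        rw [cast_hitCount, Finset.sum_apply]
      have hi : iIndepFun (fun i ω => (A n).indicator (1 : ℝ → ℝ) (X i ω)) P :=
        hindep.comp (fun _ => (A n).indicator 1) fun _ => hind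
      rw [e2, hi.mgf_sum (fun i => hind.comp (hmeas i)),
        Finset.prod_congr rfl (g := fun _ => mgf (fun ω => (A n).indicator 1 (X 0 ω)) P (-1)),
        Finset.prod_const, Finset.card_range]
      · calc _ ≤ Real.exp (-(c * P.real (X 0 ⁻¹' A n))) ^ n :=
              pow_le_pow_left₀ mgf_nonneg hm1 n
          _ = _ := by rw [← Real.exp_nat_mul]; ring_nf
      · intro i _
        exact congrFun (mgf_congr_identDistrib ((hident i).comp hind)) _
    have := measure_le_le_exp_mul_mgf (μ := P) (X := fun ω => (hitCount X (A n) n ω : ℝ))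
      (t := -1) l (by norm_num) ?_
    · refine this.trans ?_
      rw [neg_neg, one_mul]
      exact mul_le_mul_of_nonneg_left hmgf (Real.exp_pos _).le
    · have hmh := measurable_hitCount (X := X) hmeas (hA n) n
      refine Integrable.of_bound (C := 1) (by fun_prop) (.of_forall fun ω => ?_)
      rw [Real.norm_eq_abs, Real.abs_exp, Real.exp_le_one_iff]
      simp
  refine squeeze_zero (fun _ => measureReal_nonneg) hbound ?_
  have : Tendsto (fun n : ℕ => Real.exp (-(c * (n * P.real (X 0 ⁻¹' A n))))) atTop (𝓝 0) :=
    Real.tendsto_exp_neg_atTop_nhds_zero.comp (h.const_mul_atTop hc0)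
  simpa using this.const_mul (Real.exp l)

/-- Here `i` is the count in `A` and `j` the sum of both counts; `j ≥ i`, so the natural subtraction
`j - i` is exact. -/
theorem measureReal_hitCount_lt_eq_sum (hmeas : ∀ i, Measurable (X i)) {A B : Set ℝ}
    (hA : MeasurableSet A) (hB : MeasurableSet B) (n k l : ℕ) (y : ℝ) :
    P.real {ω | hitCount X A n ω < k ∧ hitCount X A n ω + hitCount X B n ω < l ∧
      (∑ q ∈ Finset.range n, X q ω) / √(n : ℝ) ≤ y}
    = ∑ i ∈ Finset.range k, ∑ j ∈ Finset.Ico i l, P.real {ω | hitCount X A n ω = i ∧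
      hitCount X B n ω = j - i ∧ (∑ q ∈ Finset.range n, X q ω) / √(n : ℝ) ≤ y} := by
  have hmA := measurable_hitCount (X := X) hmeas hA n
  have hmB := measurable_hitCount (X := X) hmeas hB n
  have hmS : Measurable fun ω => (∑ q ∈ Finset.range n, X q ω) / √(n : ℝ) :=
    (Finset.measurable_fun_sum _ fun q _ => hmeas q).div_const _
  rw [Finset.sum_sigma', ← measureReal_biUnion_finset]
  · congr 1
    ext ω
    simp only [Set.mem_ofPred_eq, Set.mem_iUnion, Finset.mem_sigma, Finset.mem_range,
      Finset.mem_Ico, exists_prop, Sigma.exists]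
    constructor
    · rintro ⟨h1, h2, h3⟩
      exact ⟨hitCount X A n ω, hitCount X A n ω + hitCount X B n ω, ⟨h1, by omega, h2⟩, rfl,
        by omega, h3⟩
    · rintro ⟨i, j, ⟨h1, h2, h3⟩, h4, h5, h6⟩
      exact ⟨by omega, by omega, h6⟩
  · rintro ⟨i, j⟩ hij ⟨i', j'⟩ hij' hne
    simp only [Finset.coe_sigma, Set.mem_sigma_iff, Finset.mem_coe, Finset.mem_range,
      Finset.mem_Ico] at hij hij'
    refine Set.disjoint_left.2 fun ω h h' => hne ?_
    obtain ⟨h1, h2, -⟩ := h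
    obtain ⟨h1', h2', -⟩ := h'
    simp only at h1 h2 h1' h2'
    obtain rfl : i = i' := by omega
    obtain rfl : j = j' := by omega
    rfl
  · rintro ⟨i, j⟩ _
    exact (hmA (measurableSet_singleton i)).inter
      ((hmB (measurableSet_singleton (j - i))).inter (hmS measurableSet_Iic))

end

/-! ### The limit theorem. -/

theorem corollary2p6 {Ω : Type*} [MeasurableSpace Ω] (P : Measure Ω) [IsProbabilityMeasure P]
    (X : ℕ → Ω → ℝ) (hmeas : ∀ i, Measurable (X i))
    (hindep : iIndepFun X P) (hident : ∀ i, IdentDistrib (X i) (X 0) P P)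
    (hmean : ∫ ω, X 0 ω ∂P = 0) (hvar : ∫ ω, (X 0 ω) ^ 2 ∂P = 1)
    (a b : ℕ → ℝ) (ha : ∀ n, 1 ≤ n → 0 < a n)
    (G : ℝ → ℝ) (hG : IsAdmissibleEVD G)
    (hmax : ∀ x : ℝ, Tendsto
      (fun n : ℕ => P.real {ω | a n * (kthLargest (fun i => X i ω) n 1 - b n) ≤ x})
      atTop (𝓝 (G x)))
    (k l : ℕ) (hk : 1 ≤ k) (hkl : k < l) (x₁ x₂ y : ℝ) (hx : x₂ ≤ x₁) :
    Tendsto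
      (fun n : ℕ => P.real {ω |
        a n * (kthLargest (fun i => X i ω) n k - b n) ≤ x₁ ∧
        a n * (kthLargest (fun i => X i ω) n l - b n) ≤ x₂ ∧
        (∑ i ∈ Finset.range n, X i ω) / Real.sqrt (n : ℝ) ≤ y})
      atTop
      (𝓝 (∑ i ∈ Finset.range k, ∑ j ∈ Finset.Ico i l,
        G x₂ * (Real.log (G x₁)⁻¹ ^ i * (Real.log (G x₂)⁻¹ - Real.log (G x₁)⁻¹) ^ (j - i) /
          ((Nat.factorial i : ℝ) * (Nat.factorial (j - i) : ℝ))) * stdNormalDF y)) := by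
  set u : ℝ → ℕ → ℝ := fun x n => x / a n + b n with hu
  have hle : ∀ (x : ℝ) {n : ℕ}, 1 ≤ n → ∀ M : ℝ, a n * (M - b n) ≤ x ↔ M ≤ u x n := by
    intro x n hn M
    rw [hu, ← sub_le_iff_le_add, le_div_iff₀' (ha n hn)]
  have hpow : ∀ x, Tendsto (fun n : ℕ => (1 - P.real (X 0 ⁻¹' Set.Ioi (u x n))) ^ n) atTop
      (𝓝 (G x)) := by
    intro x
    refine (hmax x).congr' ?_
    filter_upwards [eventually_ge_atTop 1] with n hn
    simp_rw [hle x hn]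
    exact measureReal_kthLargest_one_le hmeas hindep hident hn _
  have hG0 : ∀ x, 0 ≤ G x := fun x => ge_of_tendsto' (hmax x) fun _ => measureReal_nonneg
  have hG1 : ∀ x, G x ≤ 1 := fun x => le_of_tendsto' (hmax x) fun _ => measureReal_le_one
  have hGmono : G x₂ ≤ G x₁ := le_of_tendsto_of_tendsto' (hmax x₂) (hmax x₁) fun n =>
    measureReal_mono fun ω (hω : _ ≤ x₂) => hω.trans hx
  have hcount : ∀ᶠ n in atTop, P.real {ω |
        a n * (kthLargest (fun i => X i ω) n k - b n) ≤ x₁ ∧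
        a n * (kthLargest (fun i => X i ω) n l - b n) ≤ x₂ ∧
        (∑ i ∈ Finset.range n, X i ω) / Real.sqrt (n : ℝ) ≤ y}
      = P.real {ω | hitCount X (Set.Ioi (u x₁ n)) n ω < k ∧
        hitCount X (Set.Ioi (u x₂ n)) n ω < l ∧
        (∑ i ∈ Finset.range n, X i ω) / Real.sqrt (n : ℝ) ≤ y} := by
    -- For `n ≥ l` neither order statistic takes its default value `0`.
    filter_upwards [eventually_ge_atTop l] with n hn
    have hn1 : 1 ≤ n := by omega
    simp_rw [hle x₁ hn1, hle x₂ hn1,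
      kthLargest_le_iff_hitCount X hk (hkl.le.trans hn), kthLargest_le_iff_hitCount X (by omega : 1 ≤ l) hn]
  rcases (hG0 x₂).eq_or_lt' with hz | hpos
  -- The factor `G x₂ = 0` annihilates the sum whatever value the logarithm takes, and the event
  -- forces fewer than `l` exceedances of `u x₂ n`.
  · rw [hz]
    simp only [zero_mul, Finset.sum_const_zero]
    have hnp := tendsto_nat_mul_atTop_of_one_sub_pow (fun _ => measureReal_nonneg)
      (hz ▸ hpow x₂)
    have hlim := tendsto_measureReal_hitCount_le hmeas hindep hident
      (fun _ => measurableSet_Ioi) hnp l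
    refine squeeze_zero' (.of_forall fun _ => measureReal_nonneg) ?_ hlim
    filter_upwards [hcount] with n hn
    rw [hn]
    refine measureReal_mono fun ω hω => ?_
    exact_mod_cast hω.2.1.le
  · have hpos₁ : 0 < G x₁ := hpos.trans_le hGmono
    have hlim : ∀ {x}, 0 < G x →
        Tendsto (fun n : ℕ => n * P.real (X 0 ⁻¹' Set.Ioi (u x n))) atTop
          (𝓝 (Real.log (G x)⁻¹)) := by
      intro x hGx
      rw [Real.log_inv]
      exact tendsto_nat_mul_of_one_sub_pow (fun _ => measureReal_le_one) hGx (hpow x)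
    set τ₁ := Real.log (G x₁)⁻¹
    set τ₂ := Real.log (G x₂)⁻¹ with hτ₂
    have hτ₁0 : 0 ≤ τ₁ := Real.log_nonneg ((one_le_inv₀ hpos₁).2 (hG1 _))
    have hτ : 0 ≤ τ₂ - τ₁ :=
      sub_nonneg.2 (Real.log_le_log (inv_pos.2 hpos₁) (inv_anti₀ hpos hGmono))
    have huv : ∀ {n}, 1 ≤ n → u x₂ n ≤ u x₁ n := fun {n} hn => by
      simp only [hu]
      have := ha n hn
      gcongr
    have hB : Tendsto (fun n : ℕ => n * P.real (X 0 ⁻¹' Set.Ioc (u x₂ n) (u x₁ n))) atTop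
        (𝓝 (τ₂ - τ₁)) := by
      refine ((hlim hpos).sub (hlim hpos₁)).congr' ?_
      filter_upwards [eventually_ge_atTop 1] with n hn
      rw [← mul_sub, ← measureReal_sdiff (Set.preimage_mono (Set.Ioi_subset_Ioi (huv hn)))
        (hmeas 0 measurableSet_Ioi), ← Set.preimage_sdiff, Set.Ioi_sdiff_Ioi]
    -- The Poisson parameters are `σ = τ₁` and `ρ = τ₂ - τ₁`; their normalizing factors multiply to
    -- `exp (-τ₂) = G x₂`.
    lift τ₁ to NNReal using hτ₁0 with σ hσ
    obtain ⟨ρ, hρ⟩ : ∃ ρ : NNReal, (ρ : ℝ) = τ₂ - σ := ⟨⟨_, hτ⟩, rfl⟩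
    rw [← hρ] at hB ⊢
    have key := fun i m => tendsto_measureReal_hitCount_eq hmeas hindep hident hmean hvar
      (A := fun n => Set.Ioi (u x₁ n)) (B := fun n => Set.Ioc (u x₂ n) (u x₁ n))
      (fun _ => measurableSet_Ioi) (fun _ => measurableSet_Ioc)
      (fun n => Set.disjoint_left.2 fun z hz hz' => not_lt.2 hz'.2 hz)
      (by rw [hσ]; exact hlim hpos₁) hB i m y
    have hsum := tendsto_finsetSum (Finset.range k) fun i _ =>
      tendsto_finsetSum (Finset.Ico i l) fun j _ => key i (j - i)
    have hexp : Real.exp (-σ) * Real.exp (-ρ) = G x₂ := by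
      rw [← Real.exp_add, hρ, hτ₂, Real.log_inv]
      ring_nf
      exact Real.exp_log hpos
    have hrhs : ∀ i m : ℕ, G x₂ * ((σ : ℝ) ^ i * (ρ : ℝ) ^ m / (i.factorial * m.factorial))
        * stdNormalDF y = (Real.exp (-σ) * σ ^ i / i.factorial)
          * (Real.exp (-ρ) * ρ ^ m / m.factorial) * stdNormalDF y := by
      intro i m
      rw [← hexp]
      ring
    simp_rw [hrhs]
    refine hsum.congr' ?_
    filter_upwards [hcount, eventually_ge_atTop 1] with n hn hn1
    rw [hn, ← measureReal_hitCount_lt_eq_sum hmeas measurableSet_Ioi measurableSet_Ioc]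
    simp_rw [hitCount_Ioi_add_hitCount_Ioc X (huv hn1)]
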